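/- \textbf{Setting.} Let $M_1=4^{m_1}$, $M_2=4^{m_2}$ with integers $m_1,m_2\ge 1$, and let $E_n=\tfrac23(M_n-1)$. The square $M_n$-QAM constellation consists of the points $s_n=(A_{n,I}+jA_{n,Q})/\sqrt{E_n}$ with $A_{n,I},A_{n,Q}\in\{-(\sqrt{M_n}-1),-(\sqrt{M_n}-3),\dots,\sqrt{M_n}-1\}$. The $\log_2M_1$ bits of a symbol $s_1$ are Gray coded: bits $1,\dots,\log_2\sqrt{M_1}$ are the binary reflected Gray code (most significant bit first) of the position of $A_{1,I}$ among its $\sqrt{M_1}$ ordered values, and bits $\log_2\sqrt{M_1}+1,\dots,\log_2M_1$ are the same code for $A_{1,Q}$. Let $\mathbf h_1\in\mathbb C^{N_t}\setminus\{0\}$ be a fixed channel vector, let $\mathbf u_1,\dots,\mathbf u_{N_t}$ be an orthonormal basis of $\mathbb C^{N_t}$ with $\mathbf u_1=\mathbf h_1/\|\mathbf h_1\|$, and let $\mathbf w_1=\sum_i\rho_ie^{j\theta_i}\mathbf u_i$, $\mathbf w_2=\sum_i\delta_ie^{j\phi_i}\mathbf u_i$ with real coefficients, $\rho_1>0$ and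 $\delta_1\ge 0$. Put $\tau_1=\phi_1-\theta_1$. The symbols $s_1,s_2$ are uniformly distributed on their constellations, the noise $\nu_1\sim\mathcal{CN}(0,N_0)$ with $N_0>0$, and $s_1,s_2,\nu_1$ are mutually independent. User $U_1$ receives $y_1=\mathbf h_1^H(\mathbf w_1s_1+\mathbf w_2s_2)+\nu_1$, forms $\tilde y_1=e^{-j\angle(\mathbf h_1^H\mathbf w_1)}y_1$, and, without interference cancellation, decides for a constellation point $\hat s_1$ that minimizes $\big|\tilde y_1-|\mathbf h_1^H\mathbf w_1|\,s\big|^2$ over all points $s$ of the $M_1$-QAM constellation (ties broken arbitrarily). For $1\le i\le\log_2\sqrt{M_1}$ let \[ T_i=\sum_{k=0}^{(1-2^{-i})\sqrt{M_1}-1}\ \sum_{l=0}^{\sqrt{M_2}-1}\ \sum_{m=0}^{\sqrt{M_2}-1} D_1(i,k)\,Q\Big(g_1\big(2k+1,\,2l-\sqrt{M_2}+1,\,2m-\sqrt{M_2}+1\big)\Big), \] where $Q(x)=\frac1{\sqrt{2\pi}}\int_x^\infty e^{-t^2/2}\,dt$, \[ D_1(i,k)=(-1)^{\left\lfloor k2^{i-1}/\sqrt{M_1}\right\rfloor}\Big(2^{i-1}-\Big\lfloor\tfrac{k2^{i-1}}{\sqrt{M_1}}+\tfrac12\Big\rfloor\Big),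 \] \[ g_1(a,b,c)=\frac{\dfrac{a\,\rho_1\|\mathbf h_1\|}{\sqrt{E_1}}+\dfrac{\delta_1\|\mathbf h_1\|}{\sqrt{E_2}}\big(b\cos\tau_1+c\sin\tau_1\big)}{\sqrt{N_0/2}} . \] \textbf{Theorem.} (a) The decision variable is $\tilde y_1=\rho_1\|\mathbf h_1\|s_1+\delta_1e^{j\tau_1}\|\mathbf h_1\|s_2+\nu_1e^{-j\angle(\mathbf h_1^H\mathbf w_1)}$. (b) For every $1\le i\le\log_2\sqrt{M_1}$, the probability that the $i$-th bit of $\hat s_1$ differs from the $i$-th bit of $s_1$, and likewise the probability that the $(\log_2\sqrt{M_1}+i)$-th bits differ, equals \[ \frac{2}{M_2\sqrt{M_1}}\,T_i . \] (c) The conditional bit error rate of $U_1$ given $\mathbf h_1$, that is, the average over all $\log_2M_1$ bits of their error probabilities, equals \[ P_e^{(1)}=\frac{2}{\log_2\sqrt{M_1}}\sum_{i=1}^{\log_2\sqrt{M_1}}\frac{1}{M_2\sqrt{M_1}}\,T_i . \] -/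

import Mathlib

open MeasureTheory ProbabilityTheory
open scoped NNReal

noncomputable section

namespace MisoNoma

/-- A symbol of the square `4 ^ m`-QAM constellation, given by the positions `0, …, 2 ^ m - 1` of
its in-phase and quadrature amplitudes. The modulation order is `M = 4 ^ m`, so `√M = 2 ^ m`. -/
abbrev QAM (m : ℕ) : Type := Fin (2 ^ m) × Fin (2 ^ m)

/-- The amplitude at position `p`: the odd integers `-(√M - 1), …, √M - 1` in increasing order. -/
def amplitude (m : ℕ) (p : Fin (2 ^ m)) : ℝ := 2 * (p : ℕ) + 1 - 2 ^ m

/-- The normalization constant `E = (2 / 3) (M - 1)`. -/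
def energy (m : ℕ) : ℝ := 2 / 3 * (4 ^ m - 1)

/-- The complex constellation point `A_I / √E + j A_Q / √E`. -/
def point (m : ℕ) (s : QAM m) : ℂ :=
  ((amplitude m s.1 / √(energy m) : ℝ) : ℂ) +
    ((amplitude m s.2 / √(energy m) : ℝ) : ℂ) * Complex.I

/-- The `i`-th bit (`1 ≤ i ≤ m`, most significant bit first) of the binary reflected Gray code word
`p XOR (p >>> 1)` of the amplitude at position `p`. -/
def grayBit (m : ℕ) (p : Fin (2 ^ m)) (i : ℕ) : Bool :=
  ((p : ℕ) ^^^ ((p : ℕ) >>> 1)).testBit (m - i)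

/-- The `i`-th bit (`1 ≤ i ≤ 2 m = log₂ M`) of a Gray-coded QAM symbol: the first `log₂ √M` bits
label the in-phase amplitude and the last `log₂ √M` bits label the quadrature amplitude. -/
def symbolBit (m : ℕ) (s : QAM m) (i : ℕ) : Bool :=
  if i ≤ m then grayBit m s.1 i else grayBit m s.2 (i - m)

/-- The circularly symmetric complex Gaussian law `CN(0, N₀)`: independent centred Gaussian real and
imaginary parts of variance `N₀ / 2` each. -/
def complexGaussian (N₀ : ℝ≥0) : Measure ℂ :=
  ((gaussianReal 0 (N₀ / 2)).prod (gaussianReal 0 (N₀ / 2))).map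
    (fun z : ℝ × ℝ => (z.1 : ℂ) + (z.2 : ℂ) * Complex.I)

/-- The `Q`-function: the upper tail probability of the standard normal law. -/
def Q (x : ℝ) : ℝ := (gaussianReal 0 1).real (Set.Ioi x)

/-- A beamformer `∑ i, r i e^{j a i} u i` with amplitudes `r` and phases `a` in the basis `u`. -/
def beamformer {Nt : ℕ} (u : OrthonormalBasis (Fin Nt) ℂ (EuclideanSpace ℂ (Fin Nt)))
    (r a : Fin Nt → ℝ) : EuclideanSpace ℂ (Fin Nt) :=
  ∑ i, ((r i : ℂ) * Complex.exp ((a i : ℂ) * Complex.I)) • u i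

/-- The received signal `y = hᴴ x + ν`, where `x = w₁ s₁ + w₂ s₂`. The inner product is
conjugate-linear in its first argument, so `inner ℂ h x` is `hᴴ x`. -/
def received {Nt : ℕ} (h w₁ w₂ : EuclideanSpace ℂ (Fin Nt)) (s₁ s₂ ν : ℂ) : ℂ :=
  inner ℂ h (s₁ • w₁ + s₂ • w₂) + ν

/-- The phase-correction factor `e^{-j θ}` with `θ` the argument of `hᴴ w`. -/
def phaseCorrection {Nt : ℕ} (h w : EuclideanSpace ℂ (Fin Nt)) : ℂ :=
  Complex.exp (-((Complex.arg (inner ℂ h w) : ℝ) : ℂ) * Complex.I)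

/-- The decision variable `ỹ₁` of the first user: the received signal multiplied by the opposite of
the phase of `h₁ᴴ w₁`. -/
def decisionVar {Nt : ℕ} (h w₁ w₂ : EuclideanSpace ℂ (Fin Nt)) (s₁ s₂ ν : ℂ) : ℂ :=
  received h w₁ w₂ s₁ s₂ ν * phaseCorrection h w₁

/-- `s` minimizes `|y - c s|²` over the constellation (ties may be broken in any way). -/
def IsMLDecision (m : ℕ) (c : ℝ) (y : ℂ) (s : QAM m) : Prop :=
  ∀ t : QAM m, ‖y - (c : ℂ) * point m s‖ ^ 2 ≤ ‖y - (c : ℂ) * point m t‖ ^ 2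

/-- The probability that the `i`-th bit of the detected symbol differs from that of the sent one. -/
def bitErrorProb {Ω : Type*} [MeasurableSpace Ω] (μ : Measure Ω) (m : ℕ)
    (S Shat : Ω → QAM m) (i : ℕ) : ℝ :=
  μ.real {ω | symbolBit m (Shat ω) i ≠ symbolBit m (S ω) i}

/-- The bit error rate: the average of the error probabilities of all `log₂ M = 2 m` bits. -/
def averageBER {Ω : Type*} [MeasurableSpace Ω] (μ : Measure Ω) (m : ℕ)
    (S Shat : Ω → QAM m) : ℝ :=
  (1 / (2 * (m : ℝ))) * ∑ i ∈ Finset.Icc 1 (2 * m), bitErrorProb μ m S Shat i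

/-- `D₁(i, k) = (-1)^⌊k 2^{i-1} / √M₁⌋ (2^{i-1} - ⌊k 2^{i-1} / √M₁ + 1/2⌋)`, with `√M₁ = 2 ^ m`. -/
def D₁ (m i k : ℕ) : ℝ :=
  (-1) ^ ⌊(k : ℝ) * 2 ^ (i - 1) / 2 ^ m⌋₊ *
    (2 ^ (i - 1) - (⌊(k : ℝ) * 2 ^ (i - 1) / 2 ^ m + 1 / 2⌋₊ : ℝ))

/-- The argument `g₁(a, b, c)`, for `ρ = ρ₁`, `δ = δ₁`, `H = ‖h₁‖` and `τ = τ₁`. -/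
def g₁ (m₁ m₂ : ℕ) (ρ δ H τ N₀ a b c : ℝ) : ℝ :=
  (a * (ρ * H) / √(energy m₁) +
    δ * H / √(energy m₂) * (b * Real.cos τ + c * Real.sin τ)) / √(N₀ / 2)

/-- The triple sum `∑ k, ∑ l, ∑ m, D₁(i,k) Q(g₁(2k+1, 2l-√M₂+1, 2m-√M₂+1))`, in which `k` runs from
`0` to `(1 - 2^{-i}) √M₁ - 1` and `l`, `m` run from `0` to `√M₂ - 1`; for `i ≤ m₁` the number of
values of `k` is the natural number `2 ^ m₁ - 2 ^ (m₁ - i)`. -/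
def tripleSum (m₁ m₂ : ℕ) (ρ δ H τ N₀ : ℝ) (i : ℕ) : ℝ :=
  ∑ k ∈ Finset.range (2 ^ m₁ - 2 ^ (m₁ - i)),
    ∑ l ∈ Finset.range (2 ^ m₂), ∑ m ∈ Finset.range (2 ^ m₂),
      D₁ m₁ i k * Q (g₁ m₁ m₂ ρ δ H τ N₀ (2 * (k : ℝ) + 1)
        (2 * (l : ℝ) - 2 ^ m₂ + 1) (2 * (m : ℝ) - 2 ^ m₂ + 1))

end MisoNoma

end

/-! ### Combinatorics of Gray bits and decision thresholds. -/

namespace MisoNoma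

/-! The squared distance splits over the two axes, so each amplitude is detected separately from `d
* A + f(s₂) + R`, with `R` real Gaussian. For the `i`-th bit put `H = 2 ^ (m - i)` and `T = 2 ^ (i -
1)`: the bit flips exactly at the positions `H * (2 * t + 1)`, `t < T`, so it is the parity of the
number of these thresholds at or below the position (`testBit_gray`, `threshold_le_iff`).

A bit error is thus a parity mismatch, whose indicator is an alternating sum of threshold-crossing
indicators (`parity_ne_eq_sum`). Up to ties, a crossing says that the noise lies in a half-line
(`position_ge_iff`). Its probability, summed over the symmetric interference, depends only on the
distance `k` to the threshold. The sign also depends only on `k`, and counting the thresholds at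
each distance produces `D₁`, with a factor 2 for the two sides (`sum_positions`).
`measureReal_grayBit_ne` assembles this for one axis; both axes give the same sum by the symmetries
of the interfering constellation. -/

theorem threshold_le_iff {H : ℕ} (hH : 0 < H) (t q : ℕ) :
    H * (2 * t + 1) ≤ q ↔ t < (q + H) / (2 * H) := by
  rw [Nat.lt_iff_add_one_le, Nat.le_div_iff_mul_le (by positivity)]
  constructor <;> intro h <;> nlinarith

theorem level_le {H T q : ℕ} (hH : 0 < H) (hq : q < 2 * H * T) : (q + H) / (2 * H) ≤ T := by
  rw [← Nat.lt_add_one_iff, Nat.div_lt_iff_lt_mul (by positivity)]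
  nlinarith

/-- With `n = p / 2 ^ j`, the Gray bit is the XOR of the two lowest bits of `n`. It runs through 0,
1, 1, 0 modulo 4, as does the parity of `(n + 1) / 2`. -/
theorem testBit_gray (p j : ℕ) :
    (p ^^^ (p >>> 1)).testBit j = decide ((p + 2 ^ j) / (2 * 2 ^ j) % 2 = 1) := by
  have h1 : (p + 2 ^ j) / (2 * 2 ^ j) = (p / 2 ^ j + 1) / 2 := by
    rw [mul_comm, ← Nat.div_div_eq_div_mul, Nat.add_div_right _ (by positivity)]
  have h2 : p / 2 ^ (1 + j) = p / 2 ^ j / 2 := by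
    rw [Nat.div_div_eq_div_mul, pow_add, mul_comm, pow_one]
  rw [Nat.testBit_xor, Nat.testBit_shiftRight, Nat.testBit_eq_decide_div_mod_eq,
    Nat.testBit_eq_decide_div_mod_eq, h1, h2]
  generalize p / 2 ^ j = n
  have := Nat.div_add_mod n 4
  have h4 : n % 4 < 4 := Nat.mod_lt _ (by norm_num)
  by_cases ha : n % 2 = 1 <;> by_cases hb : n / 2 % 2 = 1 <;>
    by_cases hc : (n + 1) / 2 % 2 = 1 <;> simp [ha, hb, hc] <;> omega

/-- Only the thresholds between `a` and `b` contribute. Counted outward from `b`, their signs are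
`1, -1, 1, …`, so the sum is the parity of their number. -/
theorem parity_ne_eq_sum (T a b : ℕ) (ha : a ≤ T) (hb : b ≤ T) :
    (if a % 2 ≠ b % 2 then (1 : ℝ) else 0) =
      ∑ t ∈ Finset.range T, if b ≤ t then (if t < a then (-1) ^ (t + b) else 0)
        else (if t < a then 0 else (-1) ^ (t + b + 1)) := by
  induction a with
  | zero =>
    simp only [Nat.not_lt_zero, if_false]
    clear ha
    induction T generalizing b with
    | zero => obtain rfl : b = 0 := by omega
              simp
    | succ T ih =>
      rw [Finset.sum_range_succ]
      rcases Nat.lt_or_ge T b with h | h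
      · obtain rfl : b = T + 1 := by omega
        have := ih T le_rfl
        rw [Finset.sum_congr rfl (g := fun t => -if T ≤ t then (0 : ℝ) else (-1) ^ (t + T + 1)),
          Finset.sum_neg_distrib, ← this]
        · have h3 : (-1 : ℝ) ^ (T + (T + 1) + 1) = 1 := by
            rw [show T + (T + 1) + 1 = 2 * (T + 1) by ring, pow_mul]; simp
          have hT : ¬ (T + 1 ≤ T) := by omega
          simp only [hT, if_false, h3]
          rcases Nat.mod_two_eq_zero_or_one T with h | h <;> simp [Nat.add_mod, h]
        · intro t ht
          have ht := Finset.mem_range.1 ht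
          rw [if_neg (by omega), if_neg (by omega)]
          ring
      · rw [if_pos h, add_zero, ih b h]
  | succ a ih =>
    have h0 := ih (by omega)
    -- Raising `a` by one changes only the summand `t = a`, by `(-1) ^ (a + b)` on either side of
    -- `b`.
    have key : ∀ t ∈ Finset.range T,
        (if b ≤ t then (if t < a + 1 then (-1 : ℝ) ^ (t + b) else 0)
          else (if t < a + 1 then 0 else (-1) ^ (t + b + 1))) =
        (if b ≤ t then (if t < a then (-1 : ℝ) ^ (t + b) else 0)
          else (if t < a then 0 else (-1) ^ (t + b + 1))) +
          if t = a then (-1 : ℝ) ^ (a + b) else 0 := by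
      intro t _
      rcases lt_trichotomy t a with h | rfl | h
      · simp [h, h.ne, Nat.lt_succ_of_lt h]
      · by_cases hb : b ≤ t <;> simp [hb, pow_succ]
      · simp [h.ne', not_lt.2 h.le, show ¬ t < a + 1 by omega]
    rw [Finset.sum_congr rfl key, Finset.sum_add_distrib, ← h0, Finset.sum_ite_eq',
      if_pos (Finset.mem_range.2 (by omega))]
    rcases Nat.mod_two_eq_zero_or_one a with h | h <;>
      rcases Nat.mod_two_eq_zero_or_one b with h' | h' <;>
      simp [Nat.add_mod, h, h', neg_one_pow_eq_pow_mod_two (R := ℝ) (a + b)]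

/-- Together with `level_above`, this shows that the sign of a crossing depends only on the distance
`k` to the threshold. -/
theorem level_below {H t k : ℕ} (hH : 0 < H) (hk : k < H * (2 * t + 1)) :
    (H * (2 * t + 1) - 1 - k + H) / (2 * H) + k / (2 * H) = t := by
  have h1 := Nat.div_add_mod k (2 * H)
  have h2 := Nat.mod_lt k (show 2 * H > 0 by positivity)
  set r := k % (2 * H)
  set a := k / (2 * H)
  have h3 : a ≤ t := by
    by_contra h
    have : t + 1 ≤ a := by omega
    nlinarith [Nat.mul_le_mul_left (2 * H) this]
  obtain ⟨s, rfl⟩ := Nat.exists_eq_add_of_le h3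
  have : H * (2 * (a + s) + 1) - 1 - k + H = (2 * H - 1 - r) + 2 * H * s := by
    have e : H * (2 * (a + s) + 1) = 2 * H * a + 2 * H * s + H := by ring
    omega
  rw [this, Nat.add_mul_div_left _ _ (by positivity), Nat.div_eq_of_lt (by omega)]
  omega

theorem level_above {H : ℕ} (hH : 0 < H) (t k : ℕ) :
    (H * (2 * t + 1) + k + H) / (2 * H) = t + 1 + k / (2 * H) := by
  rw [show H * (2 * t + 1) + k + H = k + 2 * H * (t + 1) by ring,
    Nat.add_mul_div_left _ _ (by positivity)]
  ring

/-- Exchange of summation: the middle factor counts the `t < T` with `k < H * (2 * t + 1)`, and `2 *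
H * T - H` is the largest threshold. -/
theorem sum_threshold (H T : ℕ) (hH : 0 < H) (F : ℕ → ℝ) :
    ∑ t ∈ Finset.range T, ∑ k ∈ Finset.range (H * (2 * t + 1)), (-1) ^ (k / (2 * H)) * F k =
      ∑ k ∈ Finset.range (2 * H * T - H),
        (-1) ^ (k / (2 * H)) * ((T : ℝ) - ((k + H) / (2 * H) : ℕ)) * F k := by
  have h1 : ∀ t ∈ Finset.range T,
      ∑ k ∈ Finset.range (H * (2 * t + 1)), (-1) ^ (k / (2 * H)) * F k =
      ∑ k ∈ Finset.range (2 * H * T - H),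
        if k < H * (2 * t + 1) then (-1) ^ (k / (2 * H)) * F k else 0 := by
    intro t ht
    have ht := Finset.mem_range.1 ht
    rw [← Finset.sum_filter]
    congr 1
    ext k
    simp only [Finset.mem_range, Finset.mem_filter]
    have : H * (2 * t + 1) + H ≤ 2 * H * T := by nlinarith [Nat.mul_le_mul_left (2 * H) ht]
    omega
  rw [Finset.sum_congr rfl h1, Finset.sum_comm]
  refine Finset.sum_congr rfl fun k hk => ?_
  have hk := Finset.mem_range.1 hk
  rw [← Finset.sum_filter, Finset.sum_const, nsmul_eq_mul]
  have h2 : {t ∈ Finset.range T | k < H * (2 * t + 1)} = Finset.Ico ((k + H) / (2 * H)) T := by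
    ext t
    have := threshold_le_iff hH t k
    simp only [Finset.mem_range, Finset.mem_filter, Finset.mem_Ico]
    omega
  rw [h2, Nat.card_Ico, Nat.cast_sub (level_le hH (by omega))]
  ring

/-- The signed tail sum of a sent position, counted over all positions. -/
theorem sum_positions (H T : ℕ) (hH : 0 < H) (F : ℕ → ℝ) :
    ∑ p ∈ Finset.range (2 * H * T), ∑ t ∈ Finset.range T,
      (if p < H * (2 * t + 1) then
        (-1) ^ (t + (p + H) / (2 * H)) * F (H * (2 * t + 1) - 1 - p)
      else (-1) ^ (t + (p + H) / (2 * H) + 1) * F (p - H * (2 * t + 1))) =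
    2 * ∑ k ∈ Finset.range (2 * H * T - H),
        (-1) ^ (k / (2 * H)) * ((T : ℝ) - ((k + H) / (2 * H) : ℕ)) * F k := by
  rw [← sum_threshold H T hH, Finset.sum_comm, two_mul (Finset.sum _ _)]
  -- The second copy is indexed by `T - 1 - t`: as many positions lie at or above threshold `t` as
  -- lie below its mirror image.
  conv_rhs => arg 2; rw [← Finset.sum_range_reflect]
  rw [← Finset.sum_add_distrib]
  refine Finset.sum_congr rfl fun t ht => ?_
  have ht := Finset.mem_range.1 ht
  obtain ⟨s, rfl⟩ := Nat.exists_eq_add_of_lt ht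
  have e : t + s + 1 - 1 - t = s := by omega
  have hN : 2 * H * (t + s + 1) = H * (2 * t + 1) + H * (2 * s + 1) := by ring
  rw [e, hN, Finset.sum_range_add]
  congr 1
  · rw [← Finset.sum_range_reflect]
    refine Finset.sum_congr rfl fun k hk => ?_
    have hk := Finset.mem_range.1 hk
    rw [if_pos (by omega)]
    have hl := level_below hH hk
    have hs : t + (H * (2 * t + 1) - 1 - k + H) / (2 * H) =
        k / (2 * H) + 2 * ((H * (2 * t + 1) - 1 - k + H) / (2 * H)) := by omega
    rw [hs, pow_add, pow_mul, neg_one_sq, one_pow, mul_one,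
      show H * (2 * t + 1) - 1 - (H * (2 * t + 1) - 1 - k) = k by omega]
  · refine Finset.sum_congr rfl fun k hk => ?_
    rw [if_neg (by omega), level_above hH, Nat.add_sub_cancel_left]
    congr 1
    rw [show t + (t + 1 + k / (2 * H)) + 1 = k / (2 * H) + 2 * (t + 1) by ring, pow_add, pow_mul]
    simp

/-- `d * (2 * B - N)` is the midpoint between the amplitudes at positions `B - 1` and `B`; comparing
the minimizer with these two neighbours suffices. -/
theorem position_ge_iff {d x : ℝ} (hd : 0 < d) (N q B : ℕ) (hB : 1 ≤ B) (hBN : B < N)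
    (hq : ∀ t < N, (x - d * (2 * q + 1 - N)) ^ 2 ≤ (x - d * (2 * t + 1 - N)) ^ 2)
    (hx : x ≠ d * (2 * B - N)) : B ≤ q ↔ d * (2 * B - N) < x := by
  constructor
  · intro h
    refine lt_of_le_of_ne ?_ hx.symm
    by_contra! hlt
    have h1 := hq (B - 1) (by omega)
    rw [Nat.cast_sub hB] at h1
    have h2 : (B : ℝ) ≤ q := by exact_mod_cast h
    have h3 : 0 < d * (q - B + 1) := by apply mul_pos hd; linarith
    have h4 : 0 ≤ d * (q - B) := by apply mul_nonneg hd.le; linarith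
    push_cast at h1
    nlinarith [mul_pos h3 (sub_pos.2 hlt), mul_nonneg h3.le h4]
  · intro hlt
    by_contra! h
    have h1 := hq B hBN
    have h2 : (q : ℝ) + 1 ≤ B := by exact_mod_cast h
    have h3 : 0 < d * (B - q) := by apply mul_pos hd; linarith
    have h4 : 0 ≤ d * (B - q - 1) := by apply mul_nonneg hd.le; linarith
    nlinarith [mul_pos h3 (sub_pos.2 hlt), mul_nonneg h3.le h4]

end MisoNoma

namespace MisoNoma

/-! ### Gaussian laws and the error probability on one axis. -/

section Probability
variable {Ω : Type*} [MeasurableSpace Ω] {μ : Measure Ω}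

/-- Arbitrary tie-breaking may make the error event `E` non-measurable; its null-measurability is
deduced from the almost-everywhere identity. -/
theorem measureReal_eq_sum_of_indicator [IsFiniteMeasure μ] {ι : Type*} (s : Finset ι) (a : ι → ℝ)
    (A : ι → Set Ω) (hA : ∀ i, NullMeasurableSet (A i) μ) (E : Set Ω)
    (h : ∀ᵐ ω ∂μ, E.indicator (fun _ => (1 : ℝ)) ω =
      ∑ i ∈ s, a i * (A i).indicator (fun _ => (1 : ℝ)) ω) :
    μ.real E = ∑ i ∈ s, a i * μ.real (A i) := by
  have hAm : ∀ i, AEMeasurable ((A i).indicator fun _ => (1 : ℝ)) μ := fun i =>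
    (aemeasurable_indicator_const_iff 1).2 (hA i)
  have hE : NullMeasurableSet E μ := by
    rw [← aemeasurable_indicator_const_iff (1 : ℝ)]
    refine AEMeasurable.congr ?_ (Filter.EventuallyEq.symm h)
    exact Finset.aemeasurable_fun_sum _ fun i _ => (hAm i).const_mul _
  have hint : ∀ {B : Set Ω}, NullMeasurableSet B μ →
      ∫ ω, B.indicator (fun _ => (1 : ℝ)) ω ∂μ = μ.real B := by
    intro B hB
    rw [integral_indicator₀ hB]
    simp
  rw [← hint hE, integral_congr_ae h, integral_finsetSum]
  · exact Finset.sum_congr rfl fun i _ => by rw [integral_const_mul, hint (hA i)]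
  · intro i _
    exact ((integrable_const (1 : ℝ)).indicator₀ (hA i)).const_mul _

/-- Rotation invariance: the variances add up with weights `w.re ^ 2 + w.im ^ 2 = 1`. A suitable `w`
gives either axis of the rotated noise. -/
theorem hasLaw_re_complexGaussian_mul {ν : Ω → ℂ} {N₀ : ℝ≥0}
    (hν : HasLaw ν (complexGaussian N₀) μ) (w : ℂ) (hw : ‖w‖ = 1) :
    HasLaw (fun ω => (ν ω * w).re) (gaussianReal 0 (N₀ / 2)) μ := by
  set γ := gaussianReal 0 (N₀ / 2)
  have h1 : HasLaw (fun z : ℂ => (z * w).re) γ (complexGaussian N₀) := by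
    refine ⟨by fun_prop, ?_⟩
    have hm : Measurable fun z : ℂ => (z * w).re := by fun_prop
    rw [complexGaussian, Measure.map_map hm (by fun_prop)]
    have hX : HasLaw (fun z : ℝ × ℝ => z.1 * w.re) (gaussianReal (0 * w.re)
        (N₀ / 2 * NNReal.mk (w.re ^ 2) (sq_nonneg _))) (γ.prod γ) := by
      have : HasLaw (fun z : ℝ × ℝ => z.1) γ (γ.prod γ) := ⟨by fun_prop, by simp⟩
      simpa [mul_comm] using gaussianReal_mul_const this w.re
    have hY : HasLaw (fun z : ℝ × ℝ => z.2 * (-w.im)) (gaussianReal (0 * (-w.im))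
        (N₀ / 2 * NNReal.mk ((-w.im) ^ 2) (sq_nonneg _))) (γ.prod γ) := by
      have : HasLaw (fun z : ℝ × ℝ => z.2) γ (γ.prod γ) := ⟨by fun_prop, by simp⟩
      simpa [mul_comm] using gaussianReal_mul_const this (-w.im)
    have hi : IndepFun (fun z : ℝ × ℝ => z.1 * w.re) (fun z : ℝ × ℝ => z.2 * (-w.im))
        (γ.prod γ) :=
      indepFun_prod (X := fun x : ℝ => x * w.re) (Y := fun x : ℝ => x * (-w.im))
        (by fun_prop) (by fun_prop)
    have hs := (gaussianReal_add_gaussianReal_of_indepFun hi hX.map_eq hY.map_eq)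
    have hf : (fun z : ℂ => (z * w).re) ∘ (fun z : ℝ × ℝ => (z.1 : ℂ) + (z.2 : ℂ) * Complex.I) =
        (fun z : ℝ × ℝ => z.1 * w.re) + fun z : ℝ × ℝ => z.2 * (-w.im) := by
      ext z
      simp
      ring
    rw [hf, hs]
    congr 1
    · simp
    · rw [← mul_add]
      convert mul_one (N₀ / 2)
      ext
      have := Complex.sq_norm w
      rw [hw, Complex.normSq_apply] at this
      push_cast
      simp
      linarith
  exact h1.comp hν

theorem Q_div_sqrt {v : ℝ≥0} (hv : 0 < v) (x : ℝ) :
    Q (x / √(v : ℝ)) = (gaussianReal 0 v).real (Set.Ioi x) := by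
  have hs : 0 < √(v : ℝ) := Real.sqrt_pos.2 (by exact_mod_cast hv)
  have h := gaussianReal_map_const_mul (μ := 0) (v := 1) (√(v : ℝ))
  have hv' : NNReal.mk (√(v : ℝ) ^ 2) (sq_nonneg _) * 1 = v := by
    rw [mul_one]; ext; simp
  rw [mul_zero, hv'] at h
  rw [Q, ← h, map_measureReal_apply (by fun_prop) measurableSet_Ioi]
  congr 1
  ext y
  simp [div_lt_iff₀' hs]

theorem gaussianReal_real_Iic {v : ℝ≥0} (hv : 0 < v) (x : ℝ) :
    (gaussianReal 0 v).real (Set.Iic x) = (gaussianReal 0 v).real (Set.Ioi (-x)) := by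
  have := nullSingletonClass_gaussianReal (μ := 0) hv.ne'
  have h := gaussianReal_map_neg (μ := 0) (v := v)
  rw [neg_zero] at h
  rw [← measureReal_congr (Ioi_ae_eq_Ici.symm : Set.Ici (-x) =ᵐ[gaussianReal 0 v] Set.Ioi (-x))]
  nth_rewrite 1 [← h]
  rw [map_measureReal_apply (by fun_prop) measurableSet_Iic]
  congr 1
  ext y
  simp

/-- One-dimensional detection of a Gray-coded amplitude under a symmetric finitely supported
interference and Gaussian noise. -/
theorem measureReal_grayBit_ne [IsProbabilityMeasure μ] {m : ℕ} {ι : Type*} [Fintype ι]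
    {v : ℝ≥0} (hv : 0 < v) {d : ℝ} (hd : 0 < d)
    (X Y : Ω → Fin (2 ^ m)) (S : Ω → ι) (R : Ω → ℝ) (f : ι → ℝ)
    (σ : ι ≃ ι) (hσ : ∀ s, f (σ s) = -f s) (hR : HasLaw R (gaussianReal 0 v) μ)
    (hXS : ∀ p s, NullMeasurableSet {ω | X ω = p ∧ S ω = s} μ) (c : ℝ)
    (hlaw : ∀ p s (B : Set ℝ), MeasurableSet B →
      μ.real ({ω | X ω = p ∧ S ω = s} ∩ R ⁻¹' B) = c * (gaussianReal 0 v).real B)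
    (hY : ∀ ω (t : Fin (2 ^ m)),
      (d * amplitude m (X ω) + f (S ω) + R ω - d * amplitude m (Y ω)) ^ 2 ≤
      (d * amplitude m (X ω) + f (S ω) + R ω - d * amplitude m t) ^ 2)
    (i : ℕ) (hi : 1 ≤ i) (him : i ≤ m) :
    μ.real {ω | grayBit m (Y ω) i ≠ grayBit m (X ω) i} =
      2 * c * ∑ k ∈ Finset.range (2 ^ m - 2 ^ (m - i)), D₁ m i k *
        ∑ s, (gaussianReal 0 v).real (Set.Ioi (d * (2 * k + 1) + f s)) := by
  classical
  obtain ⟨T, hT⟩ : ∃ T, T = 2 ^ (i - 1) := ⟨_, rfl⟩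
  obtain ⟨H, hH⟩ : ∃ H, H = 2 ^ (m - i) := ⟨_, rfl⟩
  have hH0 : 0 < H := by rw [hH]; positivity
  have hN : 2 ^ m = 2 * H * T := by
    rw [hT, hH, mul_assoc, ← pow_add, ← pow_succ']
    congr 1; omega
  have hNR : (2 : ℝ) ^ m = 2 * H * T := by exact_mod_cast hN
  set γ := gaussianReal 0 v with hγ
  -- Noise values that carry the decision across threshold `t`: upwards if `p` lies below it,
  -- downwards otherwise.
  set J : Fin (2 ^ m) → ι → ℕ → Set ℝ := fun p s t =>
    if (p : ℕ) < H * (2 * t + 1) then Set.Ioi (d * (2 * (H * (2 * t + 1) : ℕ) - 2 * p - 1) - f s)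
    else Set.Iic (d * (2 * (H * (2 * t + 1) : ℕ) - 2 * p - 1) - f s) with hJ
  have hJm : ∀ p s t, MeasurableSet (J p s t) := by
    intro p s t
    simp only [hJ]
    split_ifs
    exacts [measurableSet_Ioi, measurableSet_Iic]
  set a : Fin (2 ^ m) → ℕ → ℝ := fun p t =>
    if (p : ℕ) < H * (2 * t + 1) then (-1) ^ (t + ((p : ℕ) + H) / (2 * H))
    else (-1) ^ (t + ((p : ℕ) + H) / (2 * H) + 1) with ha
  -- The Gaussian has no atoms, so ties at the finitely many boundaries are negligible.
  have hne : ∀ᵐ ω ∂μ, ∀ (p : Fin (2 ^ m)) (s : ι) (t : Fin T),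
      R ω ≠ d * (2 * (H * (2 * t + 1) : ℕ) - 2 * p - 1) - f s := by
    simp only [ae_all_iff]
    intro p s t
    have := nullSingletonClass_gaussianReal (μ := 0) hv.ne'
    have h1 := hR.measure_eq
      (measurableSet_singleton (d * (2 * (H * (2 * t + 1) : ℕ) - 2 * p - 1) - f s))
    rw [ae_iff]
    simp only [not_not]
    refine Eq.trans h1 ?_
    exact measure_singleton _
  have hsum : μ.real {ω | grayBit m (Y ω) i ≠ grayBit m (X ω) i} =
      ∑ x ∈ (Finset.univ : Finset (Fin (2 ^ m))) ×ˢ ((Finset.univ : Finset ι) ×ˢ Finset.range T),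
        a x.1 x.2.2 * μ.real ({ω | X ω = x.1 ∧ S ω = x.2.1} ∩ R ⁻¹' J x.1 x.2.1 x.2.2) := by
    refine measureReal_eq_sum_of_indicator _ _ _
      (fun x => (hXS _ _).inter (hR.aemeasurable.nullMeasurable (hJm _ _ _))) _ ?_
    filter_upwards [hne] with ω hω
    rw [Finset.sum_product, Finset.sum_eq_single (X ω) ?_ (by simp)]
    rotate_left
    · intro p _ hp
      exact Finset.sum_eq_zero fun x _ => by simp [hp.symm]
    rw [Finset.sum_product, Finset.sum_eq_single (S ω) ?_ (by simp)]
    rotate_left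
    · intro s _ hs
      exact Finset.sum_eq_zero fun x _ => by simp [hs.symm]
    have hp := level_le hH0 ((X ω).2.trans_eq hN)
    have hq := level_le hH0 ((Y ω).2.trans_eq hN)
    have hpar := parity_ne_eq_sum T _ _ hq hp
    refine Eq.trans ?_ (hpar.trans ?_)
    · simp only [Set.indicator_apply, Set.mem_ofPred_eq, grayBit, testBit_gray, ← hH]
      congr 1
      simp only [ne_eq, decide_eq_decide]
      apply propext
      apply not_congr
      omega
    · refine Finset.sum_congr rfl fun t ht => ?_
      have ht := Finset.mem_range.1 ht
      have hp' := threshold_le_iff hH0 t (X ω)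
      have hq' := threshold_le_iff hH0 t (Y ω)
      have hge := position_ge_iff hd (x := d * amplitude m (X ω) + f (S ω) + R ω) (2 ^ m) (Y ω)
        (H * (2 * t + 1)) (Nat.mul_pos hH0 (by omega))
        (by rw [hN]; nlinarith [Nat.mul_le_mul_left (2 * H) ht])
        (fun t ht => by simpa [amplitude] using hY ω ⟨t, ht⟩)
        (fun h => hω (X ω) (S ω) ⟨t, ht⟩ (by
          simp only [amplitude] at h
          push_cast at h ⊢
          linarith))
      have hge' : H * (2 * t + 1) ≤ (Y ω : ℕ) ↔
          d * (2 * (H * (2 * t + 1) : ℕ) - 2 * (X ω : ℕ) - 1) - f (S ω) < R ω := by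
        rw [hge]
        simp only [amplitude]
        push_cast
        constructor <;> intro h <;> linarith
      have hp'' : ((X ω : ℕ) + H) / (2 * H) ≤ t ↔ (X ω : ℕ) < H * (2 * t + 1) := by
        rw [← not_lt, ← hp', not_le]
      simp only [hp'', ← hq', hge', ha, hJ]
      by_cases h1 : (X ω : ℕ) < H * (2 * t + 1)
      · simp [h1, Set.indicator_apply]
      · simp [h1, Set.indicator_apply]
        split_ifs <;> first | rfl | (exfalso; linarith)
  set F : ℕ → ℝ := fun k => ∑ s, γ.real (Set.Ioi (d * (2 * k + 1) + f s)) with hF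
  have hJF : ∀ p t, ∑ s, γ.real (J p s t) =
      F (if (p : ℕ) < H * (2 * t + 1) then H * (2 * t + 1) - 1 - p else p - H * (2 * t + 1)) := by
    intro p t
    simp only [hJ, hF]
    split_ifs with h
    -- The symmetry `σ` turns `-f s` into `f s`; in the other case reflecting the Gaussian does so.
    · rw [← Equiv.sum_comp σ]
      refine Finset.sum_congr rfl fun s _ => ?_
      rw [hσ, Nat.sub_sub, Nat.cast_sub (by omega)]
      congr 2
      push_cast
      ring
    · refine Finset.sum_congr rfl fun s _ => ?_
      rw [gaussianReal_real_Iic hv, Nat.cast_sub (by omega)]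
      congr 2
      push_cast
      ring
  rw [hsum, Finset.sum_product]
  have hstep : ∀ p : Fin (2 ^ m), (∑ y ∈ (Finset.univ : Finset ι) ×ˢ Finset.range T,
      a p y.2 * μ.real ({ω | X ω = p ∧ S ω = y.1} ∩ R ⁻¹' J p y.1 y.2)) =
      c * ∑ t ∈ Finset.range T, (if (p : ℕ) < H * (2 * t + 1) then
        (-1) ^ (t + ((p : ℕ) + H) / (2 * H)) * F (H * (2 * t + 1) - 1 - p)
      else (-1) ^ (t + ((p : ℕ) + H) / (2 * H) + 1) * F (p - H * (2 * t + 1))) := by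
    intro p
    rw [Finset.sum_product_right, Finset.mul_sum]
    refine Finset.sum_congr rfl fun t _ => ?_
    simp only [hlaw p _ _ (hJm p _ t)]
    rw [← Finset.mul_sum, ← Finset.mul_sum, hJF]
    simp only [ha]
    split_ifs <;> ring
  rw [Finset.sum_congr rfl fun p _ => hstep p, ← Finset.mul_sum,
    Fin.sum_univ_eq_sum_range (fun p => ∑ t ∈ Finset.range T, (if p < H * (2 * t + 1) then
        (-1) ^ (t + (p + H) / (2 * H)) * F (H * (2 * t + 1) - 1 - p)
      else (-1) ^ (t + (p + H) / (2 * H) + 1) * F (p - H * (2 * t + 1)))) (2 ^ m)]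
  rw [hN, sum_positions H T hH0 F, ← hH, mul_left_comm, ← mul_assoc 2 c]
  congr 1
  refine Finset.sum_congr rfl fun k _ => ?_
  congr 1
  have hH' : (0 : ℝ) < H := by exact_mod_cast hH0
  have hT' : (0 : ℝ) < T := by rw [hT]; positivity
  -- Since `2 ^ m = 2 * H * T`, the real floors in `D₁` become natural-number divisions by `2 * H`.
  have e1 : (k : ℝ) * 2 ^ (i - 1) / 2 ^ m = (k : ℝ) / (2 * H : ℕ) := by
    rw [hNR, show (2 : ℝ) ^ (i - 1) = T by rw [hT]; push_cast; rfl]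
    push_cast
    field_simp
  have e2 : (k : ℝ) / (2 * H : ℕ) + 1 / 2 = ((k + H : ℕ) : ℝ) / (2 * H : ℕ) := by
    push_cast
    field_simp
  rw [D₁, e1, e2, Nat.floor_div_eq_div, Nat.floor_div_eq_div, hT]
  push_cast
  rfl

end Probability

end MisoNoma

/-! ### The QAM receiver: phase correction, separation of axes, joint law. -/

namespace MisoNoma

theorem point_re (m : ℕ) (s : QAM m) : (point m s).re = amplitude m s.1 / √(energy m) := by
  simp [point]

theorem point_im (m : ℕ) (s : QAM m) : (point m s).im = amplitude m s.2 / √(energy m) := by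
  simp [point]

theorem energy_pos {m : ℕ} (hm : 1 ≤ m) : 0 < energy m := by
  have : (1 : ℝ) < 4 ^ m := one_lt_pow₀ (by norm_num) (by omega)
  rw [energy]
  linarith

theorem amplitude_rev (m : ℕ) (p : Fin (2 ^ m)) : amplitude m p.rev = -amplitude m p := by
  have := p.2
  simp only [amplitude, Fin.val_rev]
  rw [Nat.cast_sub (by omega)]
  push_cast
  ring

theorem inner_beamformer {Nt : ℕ} [NeZero Nt] (h : EuclideanSpace ℂ (Fin Nt)) (hh : h ≠ 0)
    (u : OrthonormalBasis (Fin Nt) ℂ (EuclideanSpace ℂ (Fin Nt)))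
    (hu : u 0 = ((‖h‖⁻¹ : ℝ) : ℂ) • h) (r a : Fin Nt → ℝ) :
    (inner ℂ h (beamformer u r a) : ℂ) = r 0 * ‖h‖ * Complex.exp ((a 0 : ℂ) * Complex.I) := by
  have hn : (‖h‖ : ℂ) ≠ 0 := by simpa using hh
  have h0 : h = (‖h‖ : ℂ) • u 0 := by
    rw [hu, smul_smul, Complex.ofReal_inv, mul_inv_cancel₀ hn, one_smul]
  have h1 : (inner ℂ (u 0) (beamformer u r a) : ℂ) = r 0 * Complex.exp ((a 0 : ℂ) * Complex.I) := by
    rw [beamformer]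
    exact u.orthonormal.inner_right_fintype
      (fun i => (r i : ℂ) * Complex.exp ((a i : ℂ) * Complex.I)) 0
  conv_lhs => rw [h0]
  rw [inner_smul_left, h1, Complex.conj_ofReal]
  ring

theorem phaseCorrection_eq {Nt : ℕ} {h w : EuclideanSpace ℂ (Fin Nt)} {r a : ℝ} (hr : 0 < r)
    (hw : (inner ℂ h w : ℂ) = r * Complex.exp ((a : ℂ) * Complex.I)) :
    phaseCorrection h w = Complex.exp (-(a : ℂ) * Complex.I) := by
  have h1 := Complex.norm_mul_exp_arg_mul_I (inner ℂ h w)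
  have h2 : ‖(inner ℂ h w : ℂ)‖ = r := by
    rw [hw, norm_mul, Complex.norm_exp_ofReal_mul_I, Complex.norm_real, Real.norm_of_nonneg hr.le,
      mul_one]
  rw [h2] at h1
  -- The argument may differ from `a` by a multiple of `2π`, so only the exponentials are compared.
  have h3 := mul_left_cancel₀ (Complex.ofReal_ne_zero.2 hr.ne') (h1.trans hw)
  rw [phaseCorrection, neg_mul, Complex.exp_neg, h3, ← Complex.exp_neg, neg_mul]

/-- Against a competitor with the same quadrature amplitude, the imaginary parts cancel. -/
theorem IsMLDecision.re_le {m : ℕ} {c : ℝ} {y : ℂ} {s : QAM m} (h : IsMLDecision m c y s)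
    (t : Fin (2 ^ m)) : (y.re - c / √(energy m) * amplitude m s.1) ^ 2 ≤
      (y.re - c / √(energy m) * amplitude m t) ^ 2 := by
  have := h (t, s.2)
  simp only [Complex.sq_norm, Complex.normSq_apply, Complex.sub_re, Complex.sub_im,
    Complex.re_ofReal_mul, Complex.im_ofReal_mul, point_re, point_im] at this
  have e : ∀ a, c / √(energy m) * a = c * (a / √(energy m)) := fun a => by ring
  rw [e, e]
  nlinarith

theorem IsMLDecision.im_le {m : ℕ} {c : ℝ} {y : ℂ} {s : QAM m} (h : IsMLDecision m c y s)
    (t : Fin (2 ^ m)) : (y.im - c / √(energy m) * amplitude m s.2) ^ 2 ≤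
      (y.im - c / √(energy m) * amplitude m t) ^ 2 := by
  have := h (s.1, t)
  simp only [Complex.sq_norm, Complex.normSq_apply, Complex.sub_re, Complex.sub_im,
    Complex.re_ofReal_mul, Complex.im_ofReal_mul, point_re, point_im] at this
  have e : ∀ a, c / √(energy m) * a = c * (a / √(energy m)) := fun a => by ring
  rw [e, e]
  nlinarith

section Law
variable {Ω : Type*} [MeasurableSpace Ω] {μ : Measure Ω}

theorem measureReal_uniform {α : Type*} [Fintype α] [Nonempty α] [MeasurableSpace α]
    [DiscreteMeasurableSpace α] {S : Ω → α} (hS : HasLaw S (uniformOn Set.univ) μ) (s : Set α) :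
    μ.real (S ⁻¹' s) = s.ncard / Fintype.card α := by
  have := hS.measureReal_eq (p := (· ∈ s)) (MeasurableSet.of_discrete)
  refine this.trans ?_
  rw [measureReal_def, Set.ofPred_mem_eq, uniformOn_univ,
    Measure.count_apply MeasurableSet.of_discrete, ENNReal.toReal_div,
    ← (Set.toFinite s).cast_ncard_eq, ENat.toENNReal_coe, ENNReal.toReal_natCast,
    ENNReal.toReal_natCast]

/-- The joint law of one amplitude of the sent symbol, the interfering symbol and one axis of the
noise. -/
theorem joint_law [IsProbabilityMeasure μ] {m₁ m₂ : ℕ} {S₁ : Ω → QAM m₁} {S₂ : Ω → QAM m₂}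
    {ν : Ω → ℂ} {N₀ : ℝ≥0} (hS₁ : HasLaw S₁ (uniformOn Set.univ) μ)
    (hS₂ : HasLaw S₂ (uniformOn Set.univ) μ) (hindep₁ : IndepFun S₁ S₂ μ)
    (hindep₂ : IndepFun (fun ω => (S₁ ω, S₂ ω)) ν μ) (hν : HasLaw ν (complexGaussian N₀) μ)
    (w : ℂ) (hw : ‖w‖ = 1) (A : Set (QAM m₁)) (hA : A.ncard = 2 ^ m₁) (s : QAM m₂) (B : Set ℝ)
    (hB : MeasurableSet B) :
    μ.real ({ω | S₁ ω ∈ A ∧ S₂ ω = s} ∩ (fun ω => (ν ω * w).re) ⁻¹' B) =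
      1 / (4 ^ m₂ * 2 ^ m₁) * (gaussianReal 0 (N₀ / 2)).real B := by
  have hm : Measurable fun z : ℂ => (z * w).re := by fun_prop
  have h1 := hindep₂.measure_inter_preimage_eq_mul (A ×ˢ {s}) ((fun z : ℂ => (z * w).re) ⁻¹' B)
    MeasurableSet.of_discrete (hm hB)
  have h2 := hindep₁.measure_inter_preimage_eq_mul A {s}
    MeasurableSet.of_discrete MeasurableSet.of_discrete
  have e : (fun ω => (S₁ ω, S₂ ω)) ⁻¹' (A ×ˢ {s}) = S₁ ⁻¹' A ∩ S₂ ⁻¹' {s} := by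
    ext ω; simp
  rw [e] at h1
  have h3 := (hasLaw_re_complexGaussian_mul hν w hw).measureReal_eq (p := (· ∈ B)) hB
  have h4 := measureReal_uniform hS₁ A
  have h5 := measureReal_uniform hS₂ {s}
  refine (congrArg ENNReal.toReal (h1.trans (congrArg (· * _) h2))).trans ?_
  rw [ENNReal.toReal_mul, ENNReal.toReal_mul]
  refine (congrArg₂ (· * ·) (congrArg₂ (· * ·) h4 h5) h3).trans ?_
  simp only [hA, Set.ncard_singleton, Fintype.card_prod, Fintype.card_fin, Set.ofPred_mem_eq]
  have : (4 : ℝ) ^ m₂ = 2 ^ m₂ * 2 ^ m₂ := by rw [← mul_pow]; norm_num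
  rw [this]
  push_cast
  field_simp

end Law

theorem sum_Q_g₁ (m₁ m₂ : ℕ) (ρ δ H τ : ℝ) {N₀ : ℝ≥0} (hN₀ : 0 < N₀) (a : ℝ) :
    ∑ l ∈ Finset.range (2 ^ m₂), ∑ m ∈ Finset.range (2 ^ m₂),
      Q (g₁ m₁ m₂ ρ δ H τ N₀ a (2 * (l : ℝ) - 2 ^ m₂ + 1) (2 * (m : ℝ) - 2 ^ m₂ + 1)) =
    ∑ s : QAM m₂, (gaussianReal 0 (N₀ / 2)).real (Set.Ioi (ρ * H / √(energy m₁) * a +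
      δ * H / √(energy m₂) * (amplitude m₂ s.1 * Real.cos τ + amplitude m₂ s.2 * Real.sin τ))) := by
  have hv : 0 < N₀ / 2 := by positivity
  rw [Fintype.sum_prod_type]
  simp only [← Q_div_sqrt hv, amplitude,
    ← Fin.sum_univ_eq_sum_range (fun m => Q (g₁ m₁ m₂ ρ δ H τ N₀ a (2 * (_ : ℝ) - 2 ^ m₂ + 1) (2 * (m : ℝ) - 2 ^ m₂ + 1)))]
  rw [← Fin.sum_univ_eq_sum_range (fun l => ∑ m : Fin (2 ^ m₂), Q (g₁ m₁ m₂ ρ δ H τ N₀ a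
    (2 * (l : ℝ) - 2 ^ m₂ + 1) (2 * (m : ℝ) - 2 ^ m₂ + 1)))]
  refine Finset.sum_congr rfl fun l _ => Finset.sum_congr rfl fun m _ => ?_
  rw [g₁]
  push_cast
  congr 2
  ring

theorem averageBER_eq {Ω : Type*} [MeasurableSpace Ω] (μ : Measure Ω) {m : ℕ} (hm : 1 ≤ m)
    (S Shat : Ω → QAM m) (c : ℝ) (P : ℕ → ℝ)
    (h : ∀ i ∈ Finset.Icc 1 m, bitErrorProb μ m S Shat i = 2 / c * P i ∧
      bitErrorProb μ m S Shat (m + i) = 2 / c * P i) :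
    averageBER μ m S Shat = 2 / (m : ℝ) * ∑ i ∈ Finset.Icc 1 m, (1 / c * P i) := by
  have hs : ∀ f : ℕ → ℝ, ∑ i ∈ Finset.Icc 1 (2 * m), f i =
      ∑ i ∈ Finset.Icc 1 m, f i + ∑ i ∈ Finset.Icc 1 m, f (m + i) := by
    intro f
    simp only [← Finset.Ico_add_one_right_eq_Icc]
    rw [← Finset.sum_Ico_consecutive f (show 1 ≤ m + 1 by omega) (show m + 1 ≤ 2 * m + 1 by omega),
      Finset.sum_Ico_add (fun i => f i) 1 (m + 1) m]
    congr 3 <;> ring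
  have hm' : (m : ℝ) ≠ 0 := by positivity
  rw [averageBER, hs, Finset.sum_congr rfl fun i hi => (h i hi).1,
    Finset.sum_congr rfl fun i hi => (h i hi).2, ← Finset.mul_sum, ← Finset.mul_sum]
  field_simp
  ring

end MisoNoma

/-! ### The main theorem. -/

theorem mainTheorem1
    -- modulation orders `M₁ = 4 ^ m₁` and `M₂ = 4 ^ m₂`
    (m₁ m₂ : ℕ) (hm₁ : 1 ≤ m₁) (hm₂ : 1 ≤ m₂)
    -- channel and beamformers (coordinate `0` is the direction of the channel)
    (Nt : ℕ) [NeZero Nt] (h₁ : EuclideanSpace ℂ (Fin Nt)) (hh₁ : h₁ ≠ 0)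
    (u : OrthonormalBasis (Fin Nt) ℂ (EuclideanSpace ℂ (Fin Nt)))
    (hu : u 0 = ((‖h₁‖⁻¹ : ℝ) : ℂ) • h₁)
    (ρ θ δ φ : Fin Nt → ℝ) (hρ : 0 < ρ 0) (hδ : 0 ≤ δ 0)
    (w₁ w₂ : EuclideanSpace ℂ (Fin Nt))
    (hw₁ : w₁ = MisoNoma.beamformer u ρ θ) (hw₂ : w₂ = MisoNoma.beamformer u δ φ)
    (N₀ : ℝ≥0) (hN₀ : 0 < N₀)
    -- independent equiprobable symbols and noise
    {Ω : Type*} [MeasurableSpace Ω] (μ : Measure Ω) [IsProbabilityMeasure μ]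
    (S₁ : Ω → MisoNoma.QAM m₁) (S₂ : Ω → MisoNoma.QAM m₂) (ν : Ω → ℂ)
    (hS₁ : HasLaw S₁ (uniformOn Set.univ) μ) (hS₂ : HasLaw S₂ (uniformOn Set.univ) μ)
    (hν : HasLaw ν (MisoNoma.complexGaussian N₀) μ)
    (hindep₁ : IndepFun S₁ S₂ μ) (hindep₂ : IndepFun (fun ω => (S₁ ω, S₂ ω)) ν μ)
    -- decision variable and maximum likelihood decision
    (y : Ω → ℂ)
    (hy : ∀ ω, y ω = MisoNoma.decisionVar h₁ w₁ w₂
      (MisoNoma.point m₁ (S₁ ω)) (MisoNoma.point m₂ (S₂ ω)) (ν ω))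
    (Shat : Ω → MisoNoma.QAM m₁)
    (hShat : ∀ ω, MisoNoma.IsMLDecision m₁ ‖(inner ℂ h₁ w₁ : ℂ)‖ (y ω) (Shat ω)) :
    -- the decision variable is `ρ₁ ‖h₁‖ s₁ + δ₁ e^{j τ₁} ‖h₁‖ s₂` plus rotated noise
    (∀ ω, y ω = (ρ 0 : ℂ) * (‖h₁‖ : ℂ) * MisoNoma.point m₁ (S₁ ω) +
        (δ 0 : ℂ) * Complex.exp (((φ 0 - θ 0 : ℝ) : ℂ) * Complex.I) * (‖h₁‖ : ℂ) *
          MisoNoma.point m₂ (S₂ ω) +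
        ν ω * MisoNoma.phaseCorrection h₁ w₁) ∧
    -- the `i`-th in-phase bit and the `i`-th quadrature bit
    (∀ i ∈ Finset.Icc 1 m₁,
      MisoNoma.bitErrorProb μ m₁ S₁ Shat i =
        2 / (4 ^ m₂ * 2 ^ m₁) *
          MisoNoma.tripleSum m₁ m₂ (ρ 0) (δ 0) ‖h₁‖ (φ 0 - θ 0) N₀ i ∧
      MisoNoma.bitErrorProb μ m₁ S₁ Shat (m₁ + i) =
        2 / (4 ^ m₂ * 2 ^ m₁) *
          MisoNoma.tripleSum m₁ m₂ (ρ 0) (δ 0) ‖h₁‖ (φ 0 - θ 0) N₀ i) ∧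
    -- the average bit error rate, with `log₂ √M₁ = m₁`
    MisoNoma.averageBER μ m₁ S₁ Shat =
      2 / (m₁ : ℝ) * ∑ i ∈ Finset.Icc 1 m₁,
        (1 / (4 ^ m₂ * 2 ^ m₁) *
          MisoNoma.tripleSum m₁ m₂ (ρ 0) (δ 0) ‖h₁‖ (φ 0 - θ 0) N₀ i) := by
  classical
  subst hw₁ hw₂
  set w₁ := MisoNoma.beamformer u ρ θ with hw₁
  set w₂ := MisoNoma.beamformer u δ φ
  have hH : 0 < ‖h₁‖ := norm_pos_iff.2 hh₁
  have hc : 0 < ρ 0 * ‖h₁‖ := mul_pos hρ hH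
  have hi₁ := MisoNoma.inner_beamformer h₁ hh₁ u hu ρ θ
  have hi₂ := MisoNoma.inner_beamformer h₁ hh₁ u hu δ φ
  have hpc : MisoNoma.phaseCorrection h₁ w₁ = Complex.exp (-(θ 0 : ℂ) * Complex.I) :=
    MisoNoma.phaseCorrection_eq hc (by rw [hw₁, hi₁]; push_cast; ring)
  have hnorm : ‖(inner ℂ h₁ w₁ : ℂ)‖ = ρ 0 * ‖h₁‖ := by
    rw [hi₁, norm_mul, Complex.norm_exp_ofReal_mul_I, mul_one, ← Complex.ofReal_mul,
      Complex.norm_real, Real.norm_of_nonneg hc.le]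
  have hya : ∀ ω, y ω = (ρ 0 : ℂ) * (‖h₁‖ : ℂ) * MisoNoma.point m₁ (S₁ ω) +
        (δ 0 : ℂ) * Complex.exp (((φ 0 - θ 0 : ℝ) : ℂ) * Complex.I) * (‖h₁‖ : ℂ) *
          MisoNoma.point m₂ (S₂ ω) +
        ν ω * MisoNoma.phaseCorrection h₁ w₁ := by
    intro ω
    have e1 : Complex.exp ((θ 0 : ℂ) * Complex.I) * Complex.exp (-(θ 0 : ℂ) * Complex.I) = 1 := by
      rw [← Complex.exp_add]; simp
    have e2 : Complex.exp (((φ 0 - θ 0 : ℝ) : ℂ) * Complex.I) =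
        Complex.exp ((φ 0 : ℂ) * Complex.I) * Complex.exp (-(θ 0 : ℂ) * Complex.I) := by
      rw [← Complex.exp_add]; push_cast; ring_nf
    rw [hy, MisoNoma.decisionVar, MisoNoma.received, inner_add_right, inner_smul_right,
      inner_smul_right, hi₁, hi₂, hpc, e2]
    linear_combination (ρ 0 : ℂ) * (‖h₁‖ : ℂ) * MisoNoma.point m₁ (S₁ ω) * e1
  set τ := φ 0 - θ 0 with hτ
  set p := MisoNoma.phaseCorrection h₁ w₁
  have hp : ‖p‖ = 1 := by
    rw [hpc, ← Complex.ofReal_neg, Complex.norm_exp_ofReal_mul_I]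
  have hv : 0 < N₀ / 2 := by positivity
  have hE := Real.sqrt_pos.2 (MisoNoma.energy_pos hm₁)
  have hd : 0 < ρ 0 * ‖h₁‖ / √(MisoNoma.energy m₁) := div_pos hc hE
  have hmeas : ∀ (A : Set (MisoNoma.QAM m₁)) (s : MisoNoma.QAM m₂),
      NullMeasurableSet {ω | S₁ ω ∈ A ∧ S₂ ω = s} μ := fun A s =>
    (hS₁.aemeasurable.nullMeasurable (MeasurableSet.of_discrete (s := A))).inter
      (hS₂.aemeasurable.nullMeasurable (MeasurableSet.of_discrete (s := {s})))
  have hML := fun ω => hnorm ▸ hShat ω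
  have hexp : Complex.exp ((τ : ℂ) * Complex.I) = Real.cos τ + Real.sin τ * Complex.I := by
    rw [Complex.exp_mul_I, Complex.ofReal_cos, Complex.ofReal_sin]
  have hre : ∀ ω, (y ω).re = ρ 0 * ‖h₁‖ / √(MisoNoma.energy m₁) *
      MisoNoma.amplitude m₁ (S₁ ω).1 + δ 0 * ‖h₁‖ / √(MisoNoma.energy m₂) *
      (MisoNoma.amplitude m₂ (S₂ ω).1 * Real.cos τ - MisoNoma.amplitude m₂ (S₂ ω).2 * Real.sin τ) +
      (ν ω * p).re := by
    intro ω
    rw [hya, hexp]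
    simp only [Complex.add_re, Complex.mul_re, Complex.mul_im, Complex.add_im, Complex.ofReal_re,
      Complex.ofReal_im, Complex.I_re, Complex.I_im, MisoNoma.point_re, MisoNoma.point_im]
    ring
  -- The imaginary part of `z` is the real part of `z * -I`, so the quadrature noise is again a
  -- rotated real part.
  have him : ∀ ω, (y ω).im = ρ 0 * ‖h₁‖ / √(MisoNoma.energy m₁) *
      MisoNoma.amplitude m₁ (S₁ ω).2 + δ 0 * ‖h₁‖ / √(MisoNoma.energy m₂) *
      (MisoNoma.amplitude m₂ (S₂ ω).2 * Real.cos τ + MisoNoma.amplitude m₂ (S₂ ω).1 * Real.sin τ) +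
      (ν ω * (p * -Complex.I)).re := by
    intro ω
    rw [hya, hexp]
    simp only [Complex.add_re, Complex.mul_re, Complex.mul_im, Complex.add_im, Complex.ofReal_re,
      Complex.ofReal_im, Complex.I_re, Complex.I_im, Complex.neg_re, Complex.neg_im,
      MisoNoma.point_re, MisoNoma.point_im]
    ring
  have hpI : ‖p * -Complex.I‖ = 1 := by simp [hp]
  have hb : ∀ i ∈ Finset.Icc 1 m₁,
      MisoNoma.bitErrorProb μ m₁ S₁ Shat i =
        2 / (4 ^ m₂ * 2 ^ m₁) *
          MisoNoma.tripleSum m₁ m₂ (ρ 0) (δ 0) ‖h₁‖ τ N₀ i ∧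
      MisoNoma.bitErrorProb μ m₁ S₁ Shat (m₁ + i) =
        2 / (4 ^ m₂ * 2 ^ m₁) *
          MisoNoma.tripleSum m₁ m₂ (ρ 0) (δ 0) ‖h₁‖ τ N₀ i := by
    intro i hi
    obtain ⟨hi1, him1⟩ := Finset.mem_Icc.1 hi
    simp only [MisoNoma.tripleSum, ← Finset.mul_sum, MisoNoma.sum_Q_g₁ _ _ _ _ _ _ hN₀]
    constructor
    · have hfst : ∀ q : Fin (2 ^ m₁), ({s | s.1 = q} : Set (MisoNoma.QAM m₁)).ncard = 2 ^ m₁ := by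
        intro q
        rw [show ({s | s.1 = q} : Set (MisoNoma.QAM m₁)) = {q} ×ˢ Set.univ by ext; simp,
          Set.ncard_prod]
        simp
      have h := MisoNoma.measureReal_grayBit_ne (μ := μ) hv hd (fun ω => (S₁ ω).1)
        (fun ω => (Shat ω).1) S₂ (fun ω => (ν ω * p).re)
        (fun s => δ 0 * ‖h₁‖ / √(MisoNoma.energy m₂) *
          (MisoNoma.amplitude m₂ s.1 * Real.cos τ - MisoNoma.amplitude m₂ s.2 * Real.sin τ))
        -- The central symmetry `s₂ ↦ -s₂` of the constellation.
        (Fin.revPerm.prodCongr Fin.revPerm)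
        (fun s => by simp [MisoNoma.amplitude_rev]; ring)
        (MisoNoma.hasLaw_re_complexGaussian_mul hν p hp)
        (fun q s => hmeas {s | s.1 = q} s) (1 / (4 ^ m₂ * 2 ^ m₁))
        (fun q s B hB => MisoNoma.joint_law hS₁ hS₂ hindep₁ hindep₂ hν p hp {s | s.1 = q}
          (hfst q) s B hB)
        (fun ω t => by rw [← hre]; exact (hML ω).re_le t) i hi1 him1
      simp only [MisoNoma.bitErrorProb, MisoNoma.symbolBit, him1, if_true]
      rw [h, mul_one_div]
      congr 1
      refine Finset.sum_congr rfl fun k _ => ?_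
      congr 1
      -- Reversing the quadrature amplitude turns the minus before the sine into the plus of `g₁`.
      rw [← Equiv.sum_comp ((Equiv.refl (Fin (2 ^ m₂))).prodCongr Fin.revPerm)]
      refine Finset.sum_congr rfl fun s _ => ?_
      congr 2
      simp [MisoNoma.amplitude_rev]
    · have hsnd : ∀ q : Fin (2 ^ m₁), ({s | s.2 = q} : Set (MisoNoma.QAM m₁)).ncard = 2 ^ m₁ := by
        intro q
        rw [show ({s | s.2 = q} : Set (MisoNoma.QAM m₁)) = Set.univ ×ˢ {q} by ext; simp,
          Set.ncard_prod]
        simp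
      have h := MisoNoma.measureReal_grayBit_ne (μ := μ) hv hd (fun ω => (S₁ ω).2)
        (fun ω => (Shat ω).2) S₂ (fun ω => (ν ω * (p * -Complex.I)).re)
        (fun s => δ 0 * ‖h₁‖ / √(MisoNoma.energy m₂) *
          (MisoNoma.amplitude m₂ s.2 * Real.cos τ + MisoNoma.amplitude m₂ s.1 * Real.sin τ))
        (Fin.revPerm.prodCongr Fin.revPerm)
        (fun s => by simp [MisoNoma.amplitude_rev]; ring)
        (MisoNoma.hasLaw_re_complexGaussian_mul hν _ hpI)
        (fun q s => hmeas {s | s.2 = q} s) (1 / (4 ^ m₂ * 2 ^ m₁))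
        (fun q s B hB => MisoNoma.joint_law hS₁ hS₂ hindep₁ hindep₂ hν _ hpI {s | s.2 = q}
          (hsnd q) s B hB)
        (fun ω t => by rw [← him]; exact (hML ω).im_le t) i hi1 him1
      simp only [MisoNoma.bitErrorProb, MisoNoma.symbolBit,
        show ¬ (m₁ + i ≤ m₁) by omega, if_false, Nat.add_sub_cancel_left]
      rw [h, mul_one_div]
      congr 1
      refine Finset.sum_congr rfl fun k _ => ?_
      congr 1
      -- On this axis the two interfering amplitudes have exchanged roles.
      rw [← Equiv.sum_comp (Equiv.prodComm (Fin (2 ^ m₂)) (Fin (2 ^ m₂)))]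
      rfl
  exact ⟨hya, hb, MisoNoma.averageBER_eq μ hm₁ S₁ Shat _ _ hb⟩
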